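/- Let $R$ be an integral domain (commutative with $1\neq 0$), let $R^\times=R\setminus\{0\}$ be its multiplicative monoid and $(R,+)$ its discrete additive group. An isometric representation of $R$ on a Hilbert space $\mathcal H$ consists of isometries $S_r\in B(\mathcal H)$ $(r\in R^\times)$ and unitaries $U^n\in B(\mathcal H)$ $(n\in R)$ with $S_rS_t=S_{rt}$, $U^nU^m=U^{n+m}$ and $S_rU^n=U^{rn}S_r$ for all $r,t\in R^\times$ and $n,m\in R$. Let $A(R)$ be the norm closed operator algebra generated by unitaries $u^n$ $(n\in R)$ and isometries $s_r$ $(r\in R^\times)$ that is universal for isometric representations of $R$; that is, it is the norm closed algebra generated by these elements in the (direct sum) universal isometric representation, with the inherited matrix norms. Let $C^*(R,+)$ be the group $C^*$-algebra of $(R,+)$, with canonical unitaries $u^n$, and for $r\in R^\times$ let $\alpha_r$ be the $*$-endomorphism of $C^*(R,+)$ induced by the group endomorphism $n\mapsto rn$, so that $\alpha_r(u^n)=u^{rn}$. An isometric covariant representation of $(C^*(R,+),R^\times,\alpha)$ is a unital $*$-representation $\pi$ of $C^*(R,+)$ on a Hilbert space $\mathcal H$ together with isometries $S_r\in B(\mathcal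 H)$ $(r\in R^\times)$ with $S_rS_t=S_{rt}$ and $S_r\pi(a)=\pi(\alpha_r(a))S_r$ for all $r,t\in R^\times$ and $a\in C^*(R,+)$. The semicrossed product $C^*(R,+)\rtimes_\alpha R^\times$ is the norm closed operator algebra generated by the images of $C^*(R,+)$ and $R^\times$ in the universal isometric covariant representation. Then every $\alpha_r$ is injective, and $A(R)$ is completely isometrically isomorphic to $C^*(R,+)\rtimes_\alpha R^\times$: there is an algebra isomorphism $\Phi:A(R)\to C^*(R,+)\rtimes_\alpha R^\times$ such that for every $n$ the entrywise map $M_n(A(R))\to M_n(C^*(R,+)\rtimes_\alpha R^\times)$ is isometric. -/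

import Mathlib

open scoped ENNReal nonZeroDivisors

universe u v w h

noncomputable section

/-! ### Bounded families of operators -/

section Product

variable {I : Type v} (H : I → Type w) [∀ i, NormedAddCommGroup (H i)]
  [∀ i, InnerProductSpace ℂ (H i)] [∀ i, CompleteSpace (H i)] [∀ i, Nontrivial (H i)]

/-- The C⋆-algebra `∏ i, B(H i)` of all norm-bounded families of operators, with entrywise operations
and the supremum norm (equivalently, the block diagonal operators on the Hilbert sum `⨁ i, H i`). -/
abbrev OperatorFamilies : Type (max v w) := lp (fun i => H i →L[ℂ] H i) ∞

instance OperatorFamilies.instCStarAlgebra : CStarAlgebra (OperatorFamilies H) where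

end Product

/-- The family with entries `T i`, all of norm at most `C`. -/
def OperatorFamilies.mk {I : Type v} {H : I → Type w} [∀ i, NormedAddCommGroup (H i)]
    [∀ i, InnerProductSpace ℂ (H i)] [∀ i, CompleteSpace (H i)] [∀ i, Nontrivial (H i)]
    (T : ∀ i, H i →L[ℂ] H i) (C : ℝ) (hT : ∀ i, ‖T i‖ ≤ C) : OperatorFamilies H :=
  ⟨T, memℓp_infty ⟨C, by rintro _ ⟨i, rfl⟩; exact hT i⟩⟩

theorem norm_le_one_of_isometry {H : Type w} [NormedAddCommGroup H] [InnerProductSpace ℂ H]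
    {T : H →L[ℂ] H} (hT : Isometry T) : ‖T‖ ≤ 1 :=
  T.opNorm_le_bound zero_le_one fun x => by
    rw [one_mul, (AddMonoidHomClass.isometry_iff_norm T).1 hT x]

theorem norm_le_one_of_mem_unitary {H : Type w} [NormedAddCommGroup H] [InnerProductSpace ℂ H]
    [CompleteSpace H] [Nontrivial H] {T : H →L[ℂ] H} (hT : T ∈ unitary (H →L[ℂ] H)) : ‖T‖ ≤ 1 :=
  (CStarRing.norm_of_mem_unitary hT).le

/-! ### Operator algebras and complete isometries -/

/-- The C⋆-norm on `n × n` matrices over a C⋆-algebra `D`. -/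
def matrixNorm {D : Type v} [CStarAlgebra D] {n : ℕ} (M : Matrix (Fin n) (Fin n) D) : ℝ :=
  letI : PartialOrder D := CStarAlgebra.spectralOrder D
  letI : StarOrderedRing D := CStarAlgebra.spectralOrderedRing D
  ‖CStarMatrix.ofMatrix M‖

/-- For operator algebras `A ⊆ D` and `B ⊆ E` (not necessarily selfadjoint) inside C⋆-algebras, an
algebra isomorphism `Φ : A ≃ B` is completely isometric if for every `n` the entrywise map
`Mₙ(A) → Mₙ(B)` preserves the norms inherited from `Mₙ(D)` and `Mₙ(E)`. -/
def IsCompletelyIsometric {D : Type v} {E : Type w} [CStarAlgebra D] [CStarAlgebra E]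
    {A : Subalgebra ℂ D} {B : Subalgebra ℂ E} (Φ : A ≃ₐ[ℂ] B) : Prop :=
  ∀ (n : ℕ) (M : Matrix (Fin n) (Fin n) A),
    matrixNorm (M.map fun a => (Φ a : E)) = matrixNorm (M.map fun a => (a : D))

/-! ### The algebra `A(R)` -/

/-- An isometric representation of `R` on a nonzero Hilbert space: isometries `S r` (`r ≠ 0`) and
unitaries `U n` with `S r S t = S (rt)`, `U n U m = U (n + m)` and `S r U n = U (rn) S r`.
Hilbert spaces in the universe of `R` suffice, since every representation is a direct sum of
representations on spaces with a dense subset of cardinality at most `max |R| ℵ₀`. -/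
structure IsometricRep (R : Type u) [CommRing R] : Type (u + 1) where
  H : Type u
  [normed : NormedAddCommGroup H]
  [inner : InnerProductSpace ℂ H]
  [complete : CompleteSpace H]
  [nontriv : Nontrivial H]
  S : R⁰ → (H →L[ℂ] H)
  U : R → (H →L[ℂ] H)
  isometry_S : ∀ r, Isometry (S r)
  unitary_U : ∀ n, U n ∈ unitary (H →L[ℂ] H)
  S_mul : ∀ r t, S r * S t = S (r * t)
  U_mul : ∀ n m, U n * U m = U (n + m)
  S_U : ∀ r n, S r * U n = U (r * n) * S r

attribute [instance] IsometricRep.normed IsometricRep.inner IsometricRep.complete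
  IsometricRep.nontriv

namespace IntegralDomainAlgebra

variable (R : Type u) [CommRing R]

/-- The C⋆-algebra containing `A(R)`. -/
abbrev Ambient : Type (u + 1) := OperatorFamilies fun ρ : IsometricRep R => ρ.H

variable {R}

/-- The universal unitary `u n`. -/
def genU (n : R) : Ambient R :=
  OperatorFamilies.mk (fun ρ : IsometricRep R => ρ.U n) 1
    fun ρ => norm_le_one_of_mem_unitary (ρ.unitary_U n)

/-- The universal isometry `s r`. -/
def genS (r : R⁰) : Ambient R :=
  OperatorFamilies.mk (fun ρ : IsometricRep R => ρ.S r) 1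
    fun ρ => norm_le_one_of_isometry (ρ.isometry_S r)

end IntegralDomainAlgebra

/-- `A(R)`: the norm closed algebra generated by the universal unitaries `u n` and the universal
isometries `s r`. -/
def integralDomainAlgebra (R : Type u) [CommRing R] :
    Subalgebra ℂ (IntegralDomainAlgebra.Ambient R) :=
  (Algebra.adjoin ℂ (Set.range (IntegralDomainAlgebra.genU (R := R)) ∪
    Set.range (IntegralDomainAlgebra.genS (R := R)))).topologicalClosure

/-! ### Group C⋆-algebras -/

/-- A unitary representation of the discrete group `G` on a nonzero Hilbert space. -/
structure UnitaryRep (G : Type u) [Group G] : Type (u + 1) where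
  H : Type u
  [normed : NormedAddCommGroup H]
  [inner : InnerProductSpace ℂ H]
  [complete : CompleteSpace H]
  [nontriv : Nontrivial H]
  U : G →* unitary (H →L[ℂ] H)

attribute [instance] UnitaryRep.normed UnitaryRep.inner UnitaryRep.complete UnitaryRep.nontriv

/-- The pull-back of a unitary representation along a group homomorphism. -/
@[simps]
def UnitaryRep.comp {G : Type u} [Group G] (ρ : UnitaryRep G) (φ : G →* G) : UnitaryRep G where
  H := ρ.H
  U := ρ.U.comp φ

namespace GroupCStar

variable (G : Type u) [Group G]

/-- The C⋆-algebra containing `C⋆(G)`. -/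
abbrev Ambient : Type (u + 1) := OperatorFamilies fun ρ : UnitaryRep G => ρ.H

variable {G}

/-- The image of `g` in the universal representation of `G`. -/
def gen (g : G) : Ambient G :=
  OperatorFamilies.mk (fun ρ : UnitaryRep G => (ρ.U g : ρ.H →L[ℂ] ρ.H)) 1
    fun ρ => norm_le_one_of_mem_unitary (ρ.U g).2

end GroupCStar

/-- The C⋆-subalgebra generated by the universal unitary representation of `G`. -/
def GroupCStar.subalgebra (G : Type u) [Group G] : StarSubalgebra ℂ (GroupCStar.Ambient G) :=
  (StarAlgebra.adjoin ℂ (Set.range (GroupCStar.gen (G := G)))).topologicalClosure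

/-- The full group C⋆-algebra `C⋆(G)` of the discrete group `G`: the C⋆-algebra generated by `G` in
its universal unitary representation. -/
def GroupCStar (G : Type u) [Group G] : Type (u + 1) := GroupCStar.subalgebra G

namespace GroupCStar

variable {G : Type u} [Group G]

instance instIsClosed : IsClosed (subalgebra G : Set (Ambient G)) :=
  StarSubalgebra.isClosed_topologicalClosure _

instance instCStarAlgebra : CStarAlgebra (GroupCStar G) :=
  StarSubalgebra.cstarAlgebra (subalgebra G)

/-- The canonical unitary of `C⋆(G)` corresponding to `g`. -/
def of (g : G) : GroupCStar G :=
  ⟨gen g, StarSubalgebra.le_topologicalClosure _ (StarAlgebra.subset_adjoin ℂ _ ⟨g, rfl⟩)⟩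

/-- The endomorphism of the ambient algebra whose entry at `ρ` is the entry at `ρ ∘ φ`. -/
def ambientMap (φ : G →* G) : Ambient G →⋆ₐ[ℂ] Ambient G where
  toFun x := OperatorFamilies.mk (H := fun ρ : UnitaryRep G => ρ.H) (fun ρ => x (ρ.comp φ)) ‖x‖
    fun ρ => lp.norm_apply_le_norm ENNReal.top_ne_zero x (ρ.comp φ)
  map_one' := rfl
  map_mul' _ _ := rfl
  map_zero' := rfl
  map_add' _ _ := rfl
  commutes' _ := rfl
  map_star' _ := rfl

theorem ambientMap_gen (φ : G →* G) (g : G) : ambientMap φ (gen g) = gen (φ g) := rfl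

theorem norm_ambientMap_le (φ : G →* G) (x : Ambient G) : ‖ambientMap φ x‖ ≤ ‖x‖ :=
  lp.norm_le_of_forall_le (norm_nonneg x)
    fun ρ => lp.norm_apply_le_norm ENNReal.top_ne_zero x (ρ.comp φ)

theorem ambientMap_mem (φ : G →* G) {x : Ambient G} (hx : x ∈ subalgebra G) :
    ambientMap φ x ∈ subalgebra G := by
  have hc : Continuous (ambientMap φ) :=
    AddMonoidHomClass.continuous_of_bound (ambientMap φ) 1
      fun x => by simpa using norm_ambientMap_le φ x
  have hle : StarAlgebra.adjoin ℂ (Set.range (gen (G := G))) ≤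
      (subalgebra G).comap (ambientMap φ) := by
    refine StarAlgebra.adjoin_le ?_
    rintro _ ⟨g, rfl⟩
    exact (of (φ g)).2
  have hcl : IsClosed ((subalgebra G).comap (ambientMap φ) : Set (Ambient G)) :=
    (instIsClosed (G := G)).preimage hc
  exact StarSubalgebra.topologicalClosure_minimal hle hcl hx

/-- The `*`-endomorphism of `C⋆(G)` induced by the group endomorphism `φ`; by `map_of` it sends the
canonical unitary of `g` to that of `φ g`. -/
def map (φ : G →* G) : GroupCStar G →⋆ₐ[ℂ] GroupCStar G where
  toFun x := ⟨ambientMap φ x.1, ambientMap_mem φ x.2⟩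
  map_one' := rfl
  map_mul' _ _ := rfl
  map_zero' := rfl
  map_add' _ _ := rfl
  commutes' _ := rfl
  map_star' _ := rfl

theorem map_of (φ : G →* G) (g : G) : map φ (of g) = of (φ g) := rfl

theorem map_id : map (MonoidHom.id G) = 1 :=
  StarAlgHom.ext fun _ => Subtype.ext <| Subtype.ext <| funext fun _ => rfl

theorem map_comp (φ ψ : G →* G) : map (φ.comp ψ) = map φ * map ψ :=
  StarAlgHom.ext fun _ => Subtype.ext <| Subtype.ext <| funext fun _ => rfl

end GroupCStar

/-! ### Semicrossed products -/

/-- An isometric covariant representation of `(A, S, α)` on a nonzero Hilbert space: a unital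
`*`-representation `π` of `A` and isometries `V s` with `V s V t = V (st)` and
`V s π(a) = π(α s a) V s`. -/
structure IsometricCovariantRep {A : Type v} [CStarAlgebra A] {S : Type w} [Monoid S]
    (α : S →* (A →⋆ₐ[ℂ] A)) : Type (max v w (h + 1)) where
  H : Type h
  [normed : NormedAddCommGroup H]
  [inner : InnerProductSpace ℂ H]
  [complete : CompleteSpace H]
  [nontriv : Nontrivial H]
  π : A →⋆ₐ[ℂ] (H →L[ℂ] H)
  V : S → (H →L[ℂ] H)
  isometry_V : ∀ s, Isometry (V s)
  V_mul : ∀ s t, V s * V t = V (s * t)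
  covariant : ∀ s a, V s * π a = π (α s a) * V s

attribute [instance] IsometricCovariantRep.normed IsometricCovariantRep.inner
  IsometricCovariantRep.complete IsometricCovariantRep.nontriv

namespace SemicrossedProduct

variable {A : Type v} [CStarAlgebra A] {S : Type w} [Monoid S] (α : S →* (A →⋆ₐ[ℂ] A))

/-- The C⋆-algebra containing the semicrossed product. -/
abbrev Ambient : Type (max v w (h + 1)) :=
  OperatorFamilies fun ρ : IsometricCovariantRep.{v, w, h} α => ρ.H

/-- The copy of `a : A` in the universal isometric covariant representation. -/
def genA (a : A) : Ambient.{v, w, h} α :=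
  OperatorFamilies.mk (fun ρ : IsometricCovariantRep.{v, w, h} α => ρ.π a) ‖a‖
    fun ρ => NonUnitalStarAlgHom.norm_apply_le ρ.π a

/-- The universal isometry of `s : S`. -/
def genV (s : S) : Ambient.{v, w, h} α :=
  OperatorFamilies.mk (fun ρ : IsometricCovariantRep.{v, w, h} α => ρ.V s) 1
    fun ρ => norm_le_one_of_isometry (ρ.isometry_V s)

end SemicrossedProduct

/-- The semicrossed product `A ⋊_α S`: the norm closed algebra generated by `A` and `S` in the
universal isometric covariant representation (on Hilbert spaces in the universe `h`, which has to be
large enough to contain the spaces generated by one vector). -/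
def semicrossedProduct {A : Type v} [CStarAlgebra A] {S : Type w} [Monoid S]
    (α : S →* (A →⋆ₐ[ℂ] A)) : Subalgebra ℂ (SemicrossedProduct.Ambient.{v, w, h} α) :=
  (Algebra.adjoin ℂ (Set.range (SemicrossedProduct.genA.{v, w, h} α) ∪
    Set.range (SemicrossedProduct.genV.{v, w, h} α))).topologicalClosure

/-! ### The action of the multiplicative monoid of `R` on `C⋆(R, +)` -/

/-- `C⋆(R, +)`. -/
abbrev AdditiveCStar (R : Type u) [CommRing R] : Type (u + 1) := GroupCStar (Multiplicative R)

/-- The action `α` of the monoid of nonzero elements of the domain `R` on `C⋆(R, +)`: `α r` is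
induced by the endomorphism `n ↦ r * n` of `(R, +)`. -/
def multiplicationAction (R : Type u) [CommRing R] :
    R⁰ →* (AdditiveCStar R →⋆ₐ[ℂ] AdditiveCStar R) where
  toFun r := GroupCStar.map (AddMonoidHom.toMultiplicative (AddMonoidHom.mulLeft (r : R)))
  map_one' := by
    have h1 : AddMonoidHom.toMultiplicative (AddMonoidHom.mulLeft ((1 : R⁰) : R)) =
        MonoidHom.id (Multiplicative R) := by
      ext n
      exact congrArg Multiplicative.ofAdd (one_mul n)
    rw [h1, GroupCStar.map_id]
  map_mul' r t := by
    rw [← GroupCStar.map_comp]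
    congr 1
    ext n
    exact congrArg Multiplicative.ofAdd (mul_assoc (r : R) t n)

theorem multiplicationAction_of (R : Type u) [CommRing R] (r : R⁰) (n : R) :
    multiplicationAction R r (GroupCStar.of (Multiplicative.ofAdd n)) =
      GroupCStar.of (Multiplicative.ofAdd ((r : R) * n)) := rfl

end

/-! ### Completely isometric isomorphisms from `*`-isomorphisms -/

/-! Injectivity of `α r`: since `R` is a domain, `n ↦ r * n` is injective on `(R, +)`, and any
injective endomorphism `φ` of an abelian group `G` induces an injective endomorphism of `C⋆(G)`.
Indeed `C⋆(G)` is commutative, so characters separate its points. A character restricts to some `χ :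
G →* Circle`, and divisibility of the circle gives `ψ` with `ψ ∘ φ = χ`. Thus every character of
`C⋆(G)` factors through `map φ`, and the kernel is zero (`GroupCStar.map_injective`).

The isomorphism: unitary representations of `(R, +)` integrate uniquely to `C⋆(R, +)`, and by
density of the span of the unitaries the relation `S r U n = U (rn) S r` is equivalent to
covariance. So isometric representations of `R` and isometric covariant representations correspond
bijectively, on the same Hilbert spaces. Reindexing along this bijection is a `*`-isomorphism of the
two ambient products (`ambientEquiv`), hence isometric on all matrix levels, and it carries one
generated closed algebra onto the other (`map_integralDomainAlgebra`). -/

theorem matrixNorm_map {D : Type v} {E : Type w} [CStarAlgebra D] [CStarAlgebra E]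
    (Ψ : D ≃⋆ₐ[ℂ] E) {n : ℕ} (M : Matrix (Fin n) (Fin n) D) :
    matrixNorm (M.map Ψ) = matrixNorm M := by
  let _ : PartialOrder D := CStarAlgebra.spectralOrder D
  let _ : StarOrderedRing D := CStarAlgebra.spectralOrderedRing D
  let _ : PartialOrder E := CStarAlgebra.spectralOrder E
  let _ : StarOrderedRing E := CStarAlgebra.spectralOrderedRing E
  let F : CStarMatrix (Fin n) (Fin n) D →⋆ₙₐ[ℂ] CStarMatrix (Fin n) (Fin n) E :=
    CStarMatrix.mapₙₐ ((Ψ : D →⋆ₐ[ℂ] E) : D →⋆ₙₐ[ℂ] E)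
  -- An injective `*`-homomorphism of C⋆-algebras is isometric, so injectivity of the entrywise map
  -- suffices.
  have hF : Function.Injective F := fun M N hMN => by
    ext i j
    exact Ψ.injective (congrFun (congrFun hMN i) j)
  exact NonUnitalStarAlgHom.norm_map F hF (CStarMatrix.ofMatrix M)

theorem exists_isCompletelyIsometric {D : Type v} {E : Type w} [CStarAlgebra D] [CStarAlgebra E]
    (Ψ : D ≃⋆ₐ[ℂ] E) {A : Subalgebra ℂ D} {B : Subalgebra ℂ E}
    (hAB : A.map Ψ.toAlgEquiv.toAlgHom = B) : ∃ Φ : A ≃ₐ[ℂ] B, IsCompletelyIsometric Φ := by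
  subst hAB
  exact ⟨Ψ.toAlgEquiv.subalgebraMap A, fun n M => matrixNorm_map Ψ (M.map fun a => (a : D))⟩

/-- The hypotheses are asymmetric because `t` will contain all of `C⋆(R, +)`, while `s` supplies
only its unitaries; the rest of `t` is reached by limits. -/
theorem map_topologicalClosure_adjoin {D : Type v} {E : Type w} [CStarAlgebra D] [CStarAlgebra E]
    (Ψ : D ≃⋆ₐ[ℂ] E) {s : Set D} {t : Set E} (hst : ∀ x ∈ s, Ψ x ∈ t)
    (hts : t ⊆ (Algebra.adjoin ℂ (Ψ '' s)).topologicalClosure) :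
    (Algebra.adjoin ℂ s).topologicalClosure.map Ψ.toAlgEquiv.toAlgHom =
      (Algebra.adjoin ℂ t).topologicalClosure := by
  have hiso : Isometry Ψ := StarAlgEquiv.isometry Ψ
  have hclosed : IsClosedMap Ψ := hiso.isClosedEmbedding.isClosedMap
  let F : D →A[ℂ] E := ⟨Ψ.toAlgEquiv.toAlgHom, hiso.continuous⟩
  refine (Subalgebra.topologicalClosure_map F hclosed _).symm.trans ?_
  rw [AlgHom.map_adjoin]
  exact le_antisymm
    (Subalgebra.topologicalClosure_mono (Algebra.adjoin_mono (Set.image_subset_iff.2 hst)))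
    (Subalgebra.topologicalClosure_minimal (Algebra.adjoin_le hts)
      (Subalgebra.isClosed_topologicalClosure _))

/-! ### Group C⋆-algebras -/

theorem StarAlgHom.continuous_of_cstarAlgebra {A : Type v} {B : Type w} [CStarAlgebra A]
    [CStarAlgebra B] (φ : A →⋆ₐ[ℂ] B) : Continuous φ :=
  AddMonoidHomClass.continuous_of_bound φ 1 fun a => by
    rw [one_mul]
    exact NonUnitalStarAlgHom.norm_apply_le φ a

namespace GroupCStar

variable {G : Type u} [Group G]

theorem of_mul (g k : G) : of (g * k) = of g * of k :=
  Subtype.ext <| Subtype.ext <| funext fun ρ => congrArg Subtype.val (map_mul ρ.U g k)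

theorem of_one : of (1 : G) = 1 :=
  Subtype.ext <| Subtype.ext <| funext fun ρ => congrArg Subtype.val (map_one ρ.U)

theorem star_of (g : G) : star (of g) = of g⁻¹ :=
  Subtype.ext <| Subtype.ext <| funext fun ρ => congrArg Subtype.val (map_inv ρ.U g).symm

theorem of_mem_unitary (g : G) : of g ∈ unitary (GroupCStar G) := by
  rw [Unitary.mem_iff, star_of, ← of_mul, ← of_mul, inv_mul_cancel, mul_inv_cancel, of_one]
  exact ⟨rfl, rfl⟩

theorem gen_mul (g k : G) : gen (g * k) = gen g * gen k := congrArg Subtype.val (of_mul g k)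

theorem gen_one : gen (1 : G) = 1 := congrArg Subtype.val (of_one (G := G))

theorem star_gen (g : G) : star (gen g) = gen g⁻¹ := congrArg Subtype.val (star_of g)

/-- The canonical unitaries already form a monoid closed under `star`, so products and adjoints add
nothing to their linear span. -/
theorem adjoin_gen_eq_span :
    Subalgebra.toSubmodule (StarAlgebra.adjoin ℂ (Set.range (gen (G := G)))).toSubalgebra =
      Submodule.span ℂ (Set.range (gen (G := G))) := by
  let N : Submonoid (Ambient G) :=
    { carrier := Set.range gen
      one_mem' := ⟨1, gen_one⟩
      mul_mem' := by
        rintro _ _ ⟨g, rfl⟩ ⟨k, rfl⟩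
        exact ⟨g * k, gen_mul g k⟩ }
  have hN : Submonoid.closure (Set.range (gen (G := G)) ∪ star (Set.range (gen (G := G)))) = N := by
    refine le_antisymm (Submonoid.closure_le.2 (Set.union_subset le_rfl ?_))
      (fun x hx => Submonoid.subset_closure (Or.inl hx))
    rintro x ⟨g, hg⟩
    exact ⟨g⁻¹, by rw [← star_gen, hg, star_star]⟩
  rw [StarAlgebra.adjoin_eq_span, hN]
  rfl

/-- The linear span of the canonical unitaries is dense in `C⋆(G)`. -/
theorem induction_of {P : GroupCStar G → Prop} (hclosed : IsClosed {a | P a}) (hof : ∀ g, P (of g))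
    (hadd : ∀ a b, P a → P b → P (a + b)) (hsmul : ∀ (c : ℂ) a, P a → P (c • a))
    (a : GroupCStar G) : P a := by
  let W : Submodule ℂ (GroupCStar G) :=
    { carrier := {a | P a}
      add_mem' := fun {a b} ha hb => hadd a b ha hb
      zero_mem' := by simpa using hsmul 0 _ (hof 1)
      smul_mem' := hsmul }
  have hspan : Submodule.span ℂ (Set.range (gen (G := G))) ≤
      W.map (subalgebra G).subtype.toLinearMap := by
    refine Submodule.span_le.2 ?_
    rintro _ ⟨g, rfl⟩
    exact ⟨of g, hof g, rfl⟩
  -- `C⋆(G)` is a closure taken in the ambient algebra, so the closed set defined by `P` has to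
  -- remain closed there.
  have hW : IsClosed (Subtype.val '' {a : GroupCStar G | P a} : Set (Ambient G)) :=
    (instIsClosed (G := G)).isClosedEmbedding_subtypeVal.isClosedMap _ hclosed
  have hsub : (StarAlgebra.adjoin ℂ (Set.range (gen (G := G))) : Set (Ambient G)) ⊆
      Subtype.val '' {a : GroupCStar G | P a} := fun x hx => by
    have hx' : x ∈ Subalgebra.toSubmodule
      (StarAlgebra.adjoin ℂ (Set.range (gen (G := G)))).toSubalgebra := hx
    rw [adjoin_gen_eq_span] at hx'
    exact hspan hx'
  obtain ⟨b, hb, hba⟩ := closure_minimal hsub hW a.2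
  rwa [← Subtype.ext hba]

theorem starAlgHom_ext {B : Type v} [CStarAlgebra B] {φ ψ : GroupCStar G →⋆ₐ[ℂ] B}
    (hof : ∀ g, φ (of g) = ψ (of g)) : φ = ψ :=
  StarAlgHom.ext <| induction_of (isClosed_eq φ.continuous_of_cstarAlgebra
    ψ.continuous_of_cstarAlgebra) hof
    (fun a b ha hb => by rw [map_add, map_add, ha, hb])
    (fun c a ha => by rw [map_smul, map_smul, ha])

/-- The representation of `C⋆(G)` integrating a unitary representation of `G`. -/
noncomputable def integrated (ρ : UnitaryRep G) : GroupCStar G →⋆ₐ[ℂ] (ρ.H →L[ℂ] ρ.H) where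
  toFun a := a.1 ρ
  map_one' := rfl
  map_mul' _ _ := rfl
  map_zero' := rfl
  map_add' _ _ := rfl
  commutes' _ := rfl
  map_star' _ := rfl

theorem integrated_of (ρ : UnitaryRep G) (g : G) : integrated ρ (of g) = ρ.U g := rfl

/-- Holds by definition: `map φ` acts by reindexing representations along `ρ ↦ ρ.comp φ`. -/
theorem integrated_map (ρ : UnitaryRep G) (φ : G →* G) (a : GroupCStar G) :
    integrated ρ (map φ a) = integrated (ρ.comp φ) a := rfl

end GroupCStar

/-! ### Injective endomorphisms of abelian groups -/

noncomputable instance Circle.instDivisibleBy : DivisibleBy (Additive Circle) ℤ :=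
  divisibleByOfSMulRightSurj _ _ fun {n} hn x => by
    obtain ⟨t, ht⟩ := Circle.exp_surjective x.toMul
    refine ⟨Additive.ofMul (Circle.exp (t / n)), ?_⟩
    change Additive.ofMul (Circle.exp (t / n) ^ n) = x
    rw [← Circle.exp_zsmul, zsmul_eq_mul,
      mul_div_cancel₀ _ (Int.cast_ne_zero.2 hn), ht]
    rfl

/-- A divisible abelian group is an injective `ℤ`-module, by Baer's criterion. -/
theorem Circle.exists_extension {G : Type u} {K : Type v} [CommGroup G] [CommGroup K] (φ : G →* K)
    (hφ : Function.Injective φ) (χ : G →* Circle) : ∃ ψ : K →* Circle, ψ.comp φ = χ := by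
  obtain ⟨ψ, hψ⟩ := (Module.Baer.of_divisible (Additive Circle)).extension_property_addMonoidHom
    (MonoidHom.toAdditive φ) hφ (MonoidHom.toAdditive χ)
  exact ⟨MonoidHom.toAdditive.symm ψ, MonoidHom.ext fun g => DFunLike.congr_fun hψ g⟩

namespace UnitaryRep

/-- A character of `G` as a one-dimensional unitary representation. -/
noncomputable def ofCharacter {G : Type u} [Group G] (χ : G →* Circle) : UnitaryRep G where
  -- A copy of `ℂ` in the universe of `G`.
  H := EuclideanSpace ℂ PUnit.{u + 1}
  U :=
    { toFun := fun g => ⟨algebraMap ℂ _ (χ g), by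
        rw [Unitary.mem_iff, ← algebraMap_star_comm, ← map_mul, ← map_mul, mul_comm (χ g : ℂ)]
        have h : star (χ g : ℂ) * χ g = 1 := by
          rw [mul_comm]
          exact (Complex.mul_conj _).trans (by simp)
        rw [h, map_one]
        exact ⟨rfl, rfl⟩⟩
      map_one' := Subtype.ext (by simp)
      map_mul' := fun g k => Subtype.ext (by simp) }

theorem ofCharacter_U {G : Type u} [Group G] (χ : G →* Circle) (g : G) :
    ((ofCharacter χ).U g : (ofCharacter χ).H →L[ℂ] (ofCharacter χ).H) =
      algebraMap ℂ _ (χ g : ℂ) := rfl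

end UnitaryRep

namespace GroupCStar

variable {G : Type u} [CommGroup G]

theorem mul_comm_of (a b : GroupCStar G) : a * b = b * a := by
  revert b
  refine induction_of (isClosed_eq (by fun_prop) (by fun_prop)) (fun k => ?_)
    (fun b c hb hc => by rw [mul_add, add_mul, hb, hc])
    (fun z b hb => by rw [mul_smul_comm, smul_mul_assoc, hb])
  revert a
  refine induction_of (isClosed_eq (by fun_prop) (by fun_prop)) (fun g => ?_)
    (fun b c hb hc => by rw [mul_add, add_mul, hb, hc])
    (fun z b hb => by rw [mul_smul_comm, smul_mul_assoc, hb])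
  rw [← of_mul, ← of_mul, mul_comm]

noncomputable instance instCommCStarAlgebra : CommCStarAlgebra (GroupCStar G) where
  mul_comm := mul_comm_of

/-- The characters of `C⋆(G)` separate its points. -/
theorem eq_zero_of_forall_starAlgHom {a : GroupCStar G}
    (ha : ∀ χ : GroupCStar G →⋆ₐ[ℂ] ℂ, χ a = 0) : a = 0 := by
  refine (gelfandStarTransform (GroupCStar G)).injective ?_
  rw [map_zero]
  ext χ
  exact ha { WeakDual.CharacterSpace.toAlgHom χ with map_star' := fun b => map_star χ b }

/-- The restriction to `G` of a character of `C⋆(G)`. -/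
noncomputable def restrict (χ : GroupCStar G →⋆ₐ[ℂ] ℂ) : G →* Circle where
  toFun g := ⟨χ (of g), mem_sphere_zero_iff_norm.2 <| by
    have h := Unitary.map_mem χ (of_mem_unitary g)
    exact CStarRing.norm_of_mem_unitary h⟩
  map_one' := Subtype.ext ((congrArg χ of_one).trans (map_one χ))
  map_mul' g k := Subtype.ext ((congrArg χ (of_mul g k)).trans (map_mul χ _ _))

theorem map_injective {φ : G →* G} (hφ : Function.Injective φ) : Function.Injective (map φ) := by
  refine (injective_iff_map_eq_zero (map φ)).2 fun a ha => eq_zero_of_forall_starAlgHom fun χ => ?_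
  obtain ⟨ψ, hψ⟩ := Circle.exists_extension φ hφ (restrict χ)
  -- The scalar representation given by `ψ ∘ φ` is `χ` itself: the two agree on the canonical
  -- unitaries, hence everywhere by linearity and continuity.
  have key : ∀ b, integrated ((UnitaryRep.ofCharacter ψ).comp φ) b = algebraMap ℂ _ (χ b) := by
    refine induction_of (isClosed_eq
      (StarAlgHom.continuous_of_cstarAlgebra _)
      ((algebraMapCLM ℂ _).continuous.comp χ.continuous_of_cstarAlgebra)) (fun g => ?_)
      (fun b c hb hc => by rw [map_add, map_add, map_add, hb, hc])
      (fun z b hb => by rw [map_smul, map_smul, hb, smul_eq_mul, map_mul, Algebra.smul_def])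
    rw [integrated_of]
    refine (UnitaryRep.ofCharacter_U ψ (φ g)).trans (congrArg (algebraMap ℂ _) ?_)
    exact congrArg Subtype.val (DFunLike.congr_fun hψ g)
  have h := key a
  rw [← integrated_map, ha, map_zero] at h
  exact (algebraMap ℂ (((UnitaryRep.ofCharacter ψ).comp φ).H →L[ℂ] _)).injective
    (h.symm.trans (map_zero _).symm)

end GroupCStar

theorem multiplicationAction_injective {R : Type u} [CommRing R] [IsDomain R] (r : R⁰) :
    Function.Injective (multiplicationAction R r) :=
  GroupCStar.map_injective (mul_right_injective₀ (nonZeroDivisors.ne_zero r.2) :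
    Function.Injective fun n : R => (r : R) * n)

/-! ### Isometric representations and isometric covariant representations -/

namespace IsometricRep

variable {R : Type u} [CommRing R]

/-- An idempotent unitary is the identity. -/
theorem U_zero (ρ : IsometricRep R) : ρ.U 0 = 1 := by
  have h := ρ.U_mul 0 0
  rw [add_zero] at h
  calc ρ.U 0 = star (ρ.U 0) * ρ.U 0 * ρ.U 0 := by
        rw [Unitary.star_mul_self_of_mem (ρ.unitary_U 0), one_mul]
    _ = 1 := by rw [mul_assoc, h, Unitary.star_mul_self_of_mem (ρ.unitary_U 0)]

/-- The unitary representation of `(R, +)` underlying an isometric representation of `R`. -/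
def toUnitaryRep (ρ : IsometricRep R) : UnitaryRep (Multiplicative R) where
  H := ρ.H
  U :=
    { toFun := fun n => ⟨ρ.U n.toAdd, ρ.unitary_U _⟩
      map_one' := Subtype.ext ρ.U_zero
      map_mul' := fun n m => Subtype.ext (ρ.U_mul n.toAdd m.toAdd).symm }

/-- The representation of `C⋆(R, +)` integrating the unitaries of an isometric representation. -/
noncomputable def integrated (ρ : IsometricRep R) : AdditiveCStar R →⋆ₐ[ℂ] (ρ.H →L[ℂ] ρ.H) :=
  GroupCStar.integrated ρ.toUnitaryRep

theorem S_integrated (ρ : IsometricRep R) (r : R⁰) (a : AdditiveCStar R) :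
    ρ.S r * ρ.integrated a = ρ.integrated (multiplicationAction R r a) * ρ.S r := by
  have hρ : Continuous ρ.integrated := ρ.integrated.continuous_of_cstarAlgebra
  have hα : Continuous (multiplicationAction R r) :=
    (multiplicationAction R r).continuous_of_cstarAlgebra
  exact GroupCStar.induction_of
    (P := fun a => ρ.S r * ρ.integrated a = ρ.integrated (multiplicationAction R r a) * ρ.S r)
    (isClosed_eq (continuous_const.mul hρ) ((hρ.comp hα).mul continuous_const))
    (fun n => ρ.S_U r n.toAdd)
    (fun a b ha hb => by simp only [map_add, mul_add, add_mul, ha, hb])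
    (fun c a ha => by simp only [map_smul, mul_smul_comm, smul_mul_assoc, ha]) a

/-- The isometric covariant representation of `(C⋆(R, +), R⁰, α)` given by an isometric
representation of `R`. -/
noncomputable def toCovariant (ρ : IsometricRep R) :
    IsometricCovariantRep.{u + 1, u, u} (multiplicationAction R) where
  H := ρ.H
  π := ρ.integrated
  V := ρ.S
  isometry_V := ρ.isometry_S
  V_mul := ρ.S_mul
  covariant := ρ.S_integrated

end IsometricRep

namespace IsometricCovariantRep

variable {R : Type u} [CommRing R]

/-- The isometric representation of `R` given by an isometric covariant representation of
`(C⋆(R, +), R⁰, α)`. -/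
noncomputable def toIsometricRep
    (σ : IsometricCovariantRep.{u + 1, u, u} (multiplicationAction R)) : IsometricRep R where
  H := σ.H
  S := σ.V
  U n := σ.π (GroupCStar.of (Multiplicative.ofAdd n))
  isometry_S := σ.isometry_V
  unitary_U _ := Unitary.map_mem σ.π (GroupCStar.of_mem_unitary _)
  S_mul := σ.V_mul
  U_mul n m := by rw [← map_mul, ← GroupCStar.of_mul]; rfl
  S_U r n := σ.covariant r _

/-- Replacing `π` by an equal representation changes only a proof field besides; stating this for a
variable `π` lets `subst` avoid heterogeneous equalities. -/
theorem eq_of_π_eq {A : Type v} [CStarAlgebra A] {S : Type w} [Monoid S] {α : S →* (A →⋆ₐ[ℂ] A)}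
    (σ : IsometricCovariantRep.{v, w, h} α) {π : A →⋆ₐ[ℂ] (σ.H →L[ℂ] σ.H)} (hπ : π = σ.π)
    (hcov : ∀ s a, σ.V s * π a = π (α s a) * σ.V s) :
    { σ with π := π, covariant := hcov } = σ := by
  subst hπ
  rfl

theorem toCovariant_toIsometricRep
    (σ : IsometricCovariantRep.{u + 1, u, u} (multiplicationAction R)) :
    σ.toIsometricRep.toCovariant = σ :=
  σ.eq_of_π_eq (π := σ.toIsometricRep.integrated) (GroupCStar.starAlgHom_ext fun _ => rfl) _

end IsometricCovariantRep

namespace IntegralDomainAlgebra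

variable {R : Type u} [CommRing R]

/-- The isomorphism of the ambient C⋆-algebras given by the correspondence of representations. -/
noncomputable def ambientEquiv :
    Ambient R ≃⋆ₐ[ℂ] SemicrossedProduct.Ambient.{u + 1, u, u} (multiplicationAction R) where
  toFun x := OperatorFamilies.mk
    (H := fun σ : IsometricCovariantRep.{u + 1, u, u} (multiplicationAction R) => σ.H)
    (fun σ => x σ.toIsometricRep) ‖x‖
    fun σ => lp.norm_apply_le_norm ENNReal.top_ne_zero x σ.toIsometricRep
  invFun y := OperatorFamilies.mk (H := fun ρ : IsometricRep R => ρ.H)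
    (fun ρ => y ρ.toCovariant) ‖y‖
    fun ρ => lp.norm_apply_le_norm ENNReal.top_ne_zero y ρ.toCovariant
  left_inv _ := rfl
  -- Here the round trip recovers `σ` only propositionally, so the entries of the dependent family
  -- are compared by `HEq`; their types agree definitionally because the Hilbert space never
  -- changes.
  right_inv y := Subtype.ext <| funext fun σ =>
    eq_of_heq (congr_arg_heq y.1 σ.toCovariant_toIsometricRep)
  map_mul' _ _ := rfl
  map_add' _ _ := rfl
  map_smul' _ _ := rfl
  map_star' _ := rfl

theorem ambientEquiv_genS (r : R⁰) :
    ambientEquiv (genS r) = SemicrossedProduct.genV (multiplicationAction R) r := rfl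

theorem ambientEquiv_genU (n : R) :
    ambientEquiv (genU n) = SemicrossedProduct.genA (multiplicationAction R)
      (GroupCStar.of (Multiplicative.ofAdd n)) := rfl

end IntegralDomainAlgebra

namespace SemicrossedProduct

variable {A : Type v} [CStarAlgebra A] {S : Type w} [Monoid S] (α : S →* (A →⋆ₐ[ℂ] A))

theorem genA_zero : genA.{v, w, h} α 0 = 0 := Subtype.ext <| funext fun ρ => map_zero ρ.π

theorem genA_add (a b : A) : genA.{v, w, h} α (a + b) = genA α a + genA α b :=
  Subtype.ext <| funext fun ρ => map_add ρ.π a b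

theorem genA_smul (c : ℂ) (a : A) : genA.{v, w, h} α (c • a) = c • genA α a :=
  Subtype.ext <| funext fun ρ => map_smul ρ.π c a

theorem continuous_genA : Continuous (genA.{v, w, h} α) := by
  let f : A →+ Ambient.{v, w, h} α :=
    { toFun := genA α
      map_zero' := genA_zero α
      map_add' := genA_add α }
  exact AddMonoidHomClass.continuous_of_bound f 1 fun a => by
    rw [one_mul]
    exact lp.norm_le_of_forall_le (norm_nonneg a)
      fun ρ => NonUnitalStarAlgHom.norm_apply_le ρ.π a

theorem genA_mem_topologicalClosure {G : Type u} [Group G]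
    {α : S →* (GroupCStar G →⋆ₐ[ℂ] GroupCStar G)} (B : Subalgebra ℂ (Ambient.{u + 1, w, h} α))
    (hof : ∀ g, genA α (GroupCStar.of g) ∈ B.topologicalClosure) (a : GroupCStar G) :
    genA α a ∈ B.topologicalClosure :=
  GroupCStar.induction_of (P := fun a => genA α a ∈ B.topologicalClosure)
    (B.isClosed_topologicalClosure.preimage (continuous_genA α)) hof
    (fun a b ha hb => by rw [genA_add]; exact add_mem ha hb)
    (fun c a ha => by rw [genA_smul]; exact Subalgebra.smul_mem _ ha c) a

end SemicrossedProduct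

open IntegralDomainAlgebra in
theorem map_integralDomainAlgebra {R : Type u} [CommRing R] :
    (integralDomainAlgebra R).map (ambientEquiv (R := R)).toAlgEquiv.toAlgHom =
      semicrossedProduct.{u + 1, u, u} (multiplicationAction R) := by
  refine map_topologicalClosure_adjoin ambientEquiv ?_ ?_
  · rintro _ (⟨n, rfl⟩ | ⟨r, rfl⟩)
    · exact Or.inl ⟨_, (ambientEquiv_genU n).symm⟩
    · exact Or.inr ⟨r, (ambientEquiv_genS r).symm⟩
  · rintro _ (⟨a, rfl⟩ | ⟨r, rfl⟩)
    -- A general `a` need not lie in the algebra generated by the unitaries, only in its closure.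
    · refine SemicrossedProduct.genA_mem_topologicalClosure _ (fun n => ?_) a
      exact Subalgebra.le_topologicalClosure _ (Algebra.subset_adjoin
        ⟨genU n.toAdd, Or.inl ⟨_, rfl⟩, ambientEquiv_genU n.toAdd⟩)
    · exact Subalgebra.le_topologicalClosure _ (Algebra.subset_adjoin
        ⟨genS r, Or.inr ⟨_, rfl⟩, ambientEquiv_genS r⟩)

theorem proposition6 (R : Type u) [CommRing R] [IsDomain R] :
    (∀ r : R⁰, Function.Injective (multiplicationAction R r)) ∧
    ∃ Φ : integralDomainAlgebra R ≃ₐ[ℂ] semicrossedProduct.{u + 1, u, u} (multiplicationAction R),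
      IsCompletelyIsometric Φ :=
  ⟨multiplicationAction_injective,
    exists_isCompletelyIsometric IntegralDomainAlgebra.ambientEquiv map_integralDomainAlgebra⟩
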